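/- Let $\varphi(x)=\exp(-x^2)$ for $x\in\mathbb R$, with Fourier transform $\hat\varphi(\xi)=\int_{\mathbb R}\varphi(x)e^{-ix\xi}\,dx$, and let $$\sigma(\xi)=\sum_{k\in\mathbb Z}\hat\varphi(\xi+2\pi k),\qquad \xi\in\mathbb R,$$ where the series converges absolutely for every $\xi$. For each positive integer $n$ let $A_n=(\varphi(j-k))_{j,k=-n}^{n}$, a real symmetric Toeplitz matrix of order $2n+1$, and let $e^0=(\delta_{j0})_{j=-n}^{n}\in\mathbb R^{2n+1}$. The linear system $A_nc^{(n)}=e^0$ has exactly one solution $c^{(n)}=(c^{(n)}_j)_{j=-n}^{n}\in\mathbb R^{2n+1}$, and the following holds. For every $\epsilon>0$ there are positive integers $m\le n_0$ such that, for every $n\ge n_0$, $$\Bigl|\sigma(\xi)\sum_{j=-m}^{m}c^{(n)}_j e^{ij\xi}-1\Bigr|\le\epsilon\qquad\text{for all }\xi\in[0,2\pi].$$ -/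

import Mathlib

open scoped Matrix

noncomputable section

/-- The Gaussian `φ(x) = exp(-x²)`. -/
def gaussPhi (x : ℝ) : ℝ := Real.exp (-x ^ 2)

/-- The Fourier transform `f̂(ξ) = ∫ f(x) e^{-ixξ} dx` of a real-valued function on `ℝ`. -/
def fourierHat (f : ℝ → ℝ) (ξ : ℝ) : ℂ :=
  ∫ x : ℝ, (f x : ℂ) * Complex.exp (-(Complex.I * (x : ℂ) * (ξ : ℂ)))

/-- The symbol function `σ(ξ) = ∑_{k ∈ ℤ} φ̂(ξ + 2πk)` of the Gaussian. -/
def gaussSymbol (ξ : ℝ) : ℂ :=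
  ∑' k : ℤ, fourierHat gaussPhi (ξ + 2 * Real.pi * (k : ℝ))

/-- The index set `{-n, …, n}` of integers. -/
abbrev CentralIdx (n : ℕ) : Type := ↥(Finset.Icc (-(n : ℤ)) (n : ℤ))

/-- The inclusion `{-m, …, m} ⊆ {-n, …, n}` for `m ≤ n`. -/
def CentralIdx.incl {m n : ℕ} (h : m ≤ n) (j : CentralIdx m) : CentralIdx n :=
  ⟨(j : ℤ), by
    have hj := Finset.mem_Icc.mp j.2
    rw [Finset.mem_Icc]
    omega⟩

/-- The symmetric Toeplitz matrix `A_n = (φ(j - k))_{j,k=-n}^n`. -/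
def gaussToeplitz (n : ℕ) : Matrix (CentralIdx n) (CentralIdx n) ℝ :=
  Matrix.of fun j k => gaussPhi (((j : ℤ) : ℝ) - ((k : ℤ) : ℝ))

/-- The vector `e⁰ = (δ_{j0})_{j=-n}^n`. -/
def centralUnit (n : ℕ) : CentralIdx n → ℝ :=
  fun j => if (j : ℤ) = 0 then 1 else 0

/-- The trigonometric polynomial `∑_{j=-m}^m c_j e^{ijξ}`: the symbol of the bi-infinite banded
Toeplitz matrix whose entries are `c_{j-k}` for `|j - k| ≤ m` and `0` otherwise. -/
def bandedSymbol {m n : ℕ} (h : m ≤ n) (c : CentralIdx n → ℝ) (ξ : ℝ) : ℂ :=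
  ∑ j : CentralIdx m, (c (CentralIdx.incl h j) : ℂ) *
    Complex.exp (Complex.I * ((j : ℤ) : ℂ) * (ξ : ℂ))

end

/-!
The finite sections `A_n c = e⁰` are read in `L²(0, 2π)` with weight `σ`. By Poisson summation, which
for the Gaussian is the functional equation of the Jacobi theta function
(`gaussSymbol_eq_jacobiTheta₂`), `σ(ξ) = ∑ φ(k) e^{ikξ}`. Thus `σ` is smooth and periodic with Fourier
coefficients `φ(k)`; as a sum of positive Gaussians it is real and at least some `δ > 0`.

Since the Fourier coefficients of `σ` are the entries of `A_n`, the equation `A_n c = e⁰` says that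
`σ p_n - 1`, where `p_n = ∑ c_j e^{ijξ}`, is orthogonal to every trigonometric polynomial of degree at
most `n`: `p_n` is the best approximation of `1 / σ` in `L²(σ)`. Comparing it with an arbitrary
competitor `q = ∑ d_j e^{ijξ}` for which `|σ q - 1| ≤ η`, orthogonality and `σ ≥ δ` give
`|c_j - d_j| ≤ η / δ` for all `j` (`norm_sub_le_of_gaussToeplitz_mulVec_eq`). With right-hand side `0`
the same estimate gives injectivity of `A_n`, hence unique solvability.

The competitors are the Fourier partial sums `q_n` of `1 / σ`. This function is `C²` and periodic, so
its Fourier series converges uniformly (`exists_uniform_fourier_series`), and `σ q_n → 1` uniformly.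
Choose `m` with `|σ q_m - 1| ≤ ε / 2`. As `n → ∞` the finitely many coefficients `c_j^{(n)}` with
`|j| ≤ m` converge to those of `q_m`, so that replacing `q_m` by the truncation of `p_n` costs at most
another `ε / 2` once `n` is large.
-/

open Complex MeasureTheory Filter Topology ComplexConjugate

/-! ### Trigonometric polynomials -/

/-- The character `ξ ↦ e^{ijξ}`. -/
noncomputable def expMode (j : ℤ) (ξ : ℝ) : ℂ := cexp (I * (j : ℂ) * (ξ : ℂ))

theorem expMode_zero (ξ : ℝ) : expMode 0 ξ = 1 := by simp [expMode]

theorem expMode_add (j k : ℤ) (ξ : ℝ) : expMode (j + k) ξ = expMode j ξ * expMode k ξ := by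
  rw [expMode, expMode, expMode, ← Complex.exp_add]
  push_cast
  ring_nf

theorem norm_expMode (j : ℤ) (ξ : ℝ) : ‖expMode j ξ‖ = 1 := by
  rw [expMode, show I * (j : ℂ) * (ξ : ℂ) = ((j * ξ : ℝ) : ℂ) * I by push_cast; ring,
    norm_exp_ofReal_mul_I]

theorem conj_expMode (j : ℤ) (ξ : ℝ) : conj (expMode j ξ) = expMode (-j) ξ := by
  simp [expMode, ← Complex.exp_conj]

theorem continuous_expMode (j : ℤ) : Continuous (expMode j) := by
  unfold expMode; fun_prop

theorem integral_expMode (j : ℤ) :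
    ∫ ξ in (0 : ℝ)..2 * Real.pi, expMode j ξ = if j = 0 then 2 * (Real.pi : ℂ) else 0 := by
  split_ifs with h
  · simp [h, expMode_zero]
  · have hj : I * (j : ℂ) ≠ 0 := mul_ne_zero I_ne_zero (by exact_mod_cast h)
    simp only [expMode]
    rw [integral_exp_mul_complex hj,
      show I * (j : ℂ) * ((2 * Real.pi : ℝ) : ℂ) = (j : ℂ) * (2 * Real.pi * I) by push_cast; ring,
      exp_int_mul_two_pi_mul_I]
    simp

/-- The trigonometric polynomial `∑_{j=-n}^n a_j e^{ijξ}`. -/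
noncomputable def trigPoly {n : ℕ} (a : CentralIdx n → ℂ) (ξ : ℝ) : ℂ :=
  ∑ j, a j * expMode (j : ℤ) ξ

theorem continuous_trigPoly {n : ℕ} (a : CentralIdx n → ℂ) : Continuous (trigPoly a) :=
  continuous_finsetSum _ fun _ _ => continuous_const.mul (continuous_expMode _)

theorem trigPoly_sub {n : ℕ} (a b : CentralIdx n → ℂ) (ξ : ℝ) :
    trigPoly (a - b) ξ = trigPoly a ξ - trigPoly b ξ := by
  simp [trigPoly, sub_mul]

theorem norm_trigPoly_le {n : ℕ} {a : CentralIdx n → ℂ} {C : ℝ} (h : ∀ j, ‖a j‖ ≤ C) (ξ : ℝ) :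
    ‖trigPoly a ξ‖ ≤ (2 * n + 1) * C := by
  have hc : Fintype.card (CentralIdx n) = 2 * n + 1 := by
    rw [Fintype.card_coe, Int.card_Icc]; omega
  refine (norm_sum_le _ _).trans ((Finset.sum_le_card_nsmul _ _ C fun j _ => ?_).trans_eq ?_)
  · rw [norm_mul, norm_expMode, mul_one]; exact h j
  · rw [Finset.card_univ, hc, nsmul_eq_mul]; push_cast; ring

theorem integral_mul_conj_trigPoly {n : ℕ} {G : ℝ → ℂ} (hG : Continuous G)
    (a : CentralIdx n → ℂ) :
    ∫ ξ in (0 : ℝ)..2 * Real.pi, G ξ * conj (trigPoly a ξ) =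
      ∑ j, conj (a j) * ∫ ξ in (0 : ℝ)..2 * Real.pi, G ξ * expMode (-(j : ℤ)) ξ := by
  simp only [← intervalIntegral.integral_const_mul]
  rw [← intervalIntegral.integral_finsetSum]
  · refine intervalIntegral.integral_congr fun ξ _ => ?_
    simp only [trigPoly, map_sum, map_mul, conj_expMode, Finset.mul_sum]
    exact Finset.sum_congr rfl fun j _ => by ring
  · exact fun j _ => (continuous_const.mul
      (hG.mul (continuous_expMode _))).intervalIntegrable _ _

theorem integral_trigPoly_mul_expMode {n : ℕ} (a : CentralIdx n → ℂ) (j : CentralIdx n) :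
    ∫ ξ in (0 : ℝ)..2 * Real.pi, trigPoly a ξ * expMode (-(j : ℤ)) ξ = 2 * Real.pi * a j := by
  simp only [trigPoly, Finset.sum_mul, mul_assoc, ← expMode_add]
  rw [intervalIntegral.integral_finsetSum]
  · simp only [intervalIntegral.integral_const_mul, integral_expMode, mul_ite, mul_zero]
    rw [Finset.sum_eq_single j]
    · simp; ring
    · intro k _ hk
      rw [if_neg]
      rw [← sub_eq_add_neg, sub_eq_zero]
      exact fun h => hk (Subtype.ext h)
    · simp
  · exact fun k _ => (continuous_const.mul (continuous_expMode _)).intervalIntegrable _ _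

/-- Parseval's identity for trigonometric polynomials. -/
theorem integral_norm_sq_trigPoly {n : ℕ} (a : CentralIdx n → ℂ) :
    ∫ ξ in (0 : ℝ)..2 * Real.pi, ‖trigPoly a ξ‖ ^ 2 = 2 * Real.pi * ∑ j, ‖a j‖ ^ 2 := by
  have h := integral_mul_conj_trigPoly (continuous_trigPoly a) a
  simp only [integral_trigPoly_mul_expMode, mul_conj'] at h
  apply ofReal_injective
  rw [← intervalIntegral.integral_ofReal]
  push_cast
  rw [h, Finset.mul_sum]
  refine Finset.sum_congr rfl fun j _ => ?_
  rw [← mul_conj']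
  ring

/-! ### The symbol as a theta function -/

theorem fourierHat_gaussPhi (t : ℝ) :
    fourierHat gaussPhi t = ((√Real.pi * Real.exp (-t ^ 2 / 4) : ℝ) : ℂ) := by
  have h := fourierIntegral_gaussian (b := 1) (by simp) (-(t : ℂ))
  have hs : ((Real.pi : ℂ) / 1) ^ (1 / 2 : ℂ) = ((√Real.pi : ℝ) : ℂ) := by
    rw [div_one, Real.sqrt_eq_rpow, ofReal_cpow Real.pi_pos.le]; simp
  rw [hs] at h
  rw [fourierHat]
  push_cast
  convert h using 1
  · refine integral_congr_ae (ae_of_all _ fun x => ?_)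
    simp only [gaussPhi]
    push_cast
    rw [mul_comm]
    ring_nf
  · simp

/-- The summands of the symbol are, up to a factor independent of `k`, the terms of a Jacobi theta
series with parameter `πi`. -/
theorem fourierHat_gaussPhi_add (ξ : ℝ) (k : ℤ) :
    fourierHat gaussPhi (ξ + 2 * Real.pi * (k : ℝ)) =
      ((√Real.pi : ℝ) : ℂ) * cexp (-(ξ : ℂ) ^ 2 / 4) *
        jacobiTheta₂_term k (I * ξ / 2) (Real.pi * I) := by
  rw [fourierHat_gaussPhi, jacobiTheta₂_term, mul_assoc (√Real.pi : ℂ), ← Complex.exp_add]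
  push_cast
  congr 2
  linear_combination (-(Real.pi * k * ξ) - Real.pi ^ 2 * k ^ 2) * I_sq

theorem summable_fourierHat_gaussPhi (ξ : ℝ) :
    Summable fun k : ℤ => fourierHat gaussPhi (ξ + 2 * Real.pi * (k : ℝ)) := by
  simp only [fourierHat_gaussPhi_add]
  exact ((summable_jacobiTheta₂_term_iff _ _).2 (by simpa using Real.pi_pos)).mul_left _

/-- Poisson summation for the Gaussian, in the guise of the functional equation of the theta
function. -/
theorem gaussSymbol_eq_jacobiTheta₂ (ξ : ℝ) :
    gaussSymbol ξ = jacobiTheta₂ (ξ / (2 * Real.pi)) (I / Real.pi) := by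
  have hpi : (Real.pi : ℂ) ≠ 0 := ofReal_ne_zero.2 Real.pi_ne_zero
  have hs : 1 / (-I * (I / Real.pi)) ^ (1 / 2 : ℂ) = ((√Real.pi : ℝ) : ℂ) := by
    have : -I * (I / Real.pi) = ((Real.pi⁻¹ : ℝ) : ℂ) := by
      push_cast; linear_combination (-(Real.pi : ℂ)⁻¹) * I_sq
    rw [this, show (1 / 2 : ℂ) = ((1 / 2 : ℝ) : ℂ) by simp,
      ← ofReal_cpow (inv_pos.2 Real.pi_pos).le, ← Real.sqrt_eq_rpow, Real.sqrt_inv]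
    simp
  rw [jacobiTheta₂_functional_equation, hs, gaussSymbol]
  simp only [fourierHat_gaussPhi_add]
  rw [tsum_mul_left, ← jacobiTheta₂, ← jacobiTheta₂_neg_left]
  congr 2
  · congr 1
    field_simp
    ring
  · field_simp
    linear_combination (-(ξ : ℂ)) * I_sq
  · field_simp
    linear_combination I_sq

theorem hasSum_gaussSymbol (ξ : ℝ) :
    HasSum (fun k : ℤ => (gaussPhi k : ℂ) * expMode k ξ) (gaussSymbol ξ) := by
  have hpi : (Real.pi : ℂ) ≠ 0 := ofReal_ne_zero.2 Real.pi_ne_zero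
  rw [gaussSymbol_eq_jacobiTheta₂]
  convert hasSum_jacobiTheta₂_term (ξ / (2 * Real.pi)) (τ := I / Real.pi) ?_ using 2 with k
  · simp only [gaussPhi, expMode, jacobiTheta₂_term]
    push_cast
    rw [← Complex.exp_add]
    congr 1
    field_simp
    linear_combination (-(k : ℂ) ^ 2) * I_sq
  · rw [div_ofReal_im]; simpa using Real.pi_pos

theorem summable_gaussPhi : Summable fun k : ℤ => gaussPhi k := by
  have := (hasSum_gaussSymbol 0).summable
  rw [← Complex.summable_ofReal]
  simpa [expMode] using this

theorem contDiff_gaussSymbol : ContDiff ℝ ⊤ gaussSymbol := by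
  have hd : Differentiable ℂ fun z : ℂ => jacobiTheta₂ (z / (2 * Real.pi)) (I / Real.pi) := fun z =>
    (differentiableAt_jacobiTheta₂_fst (z / (2 * Real.pi)) (τ := I / Real.pi)
      (by rw [div_ofReal_im]; simpa using Real.pi_pos)).comp (f := fun z : ℂ => z / (2 * Real.pi)) z
        (differentiableAt_id.div_const _)
  have h : gaussSymbol = (fun z : ℂ => jacobiTheta₂ (z / (2 * Real.pi)) (I / Real.pi)) ∘
      ((↑) : ℝ → ℂ) := funext gaussSymbol_eq_jacobiTheta₂
  rw [h]
  exact (hd.contDiff.restrict_scalars ℝ).comp ofRealCLM.contDiff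

theorem gaussSymbol_periodic : Function.Periodic gaussSymbol (2 * Real.pi) := by
  intro ξ
  rw [gaussSymbol_eq_jacobiTheta₂, gaussSymbol_eq_jacobiTheta₂,
    ← jacobiTheta₂_add_left (ξ / (2 * Real.pi))]
  congr 1
  have hpi : (Real.pi : ℂ) ≠ 0 := ofReal_ne_zero.2 Real.pi_ne_zero
  push_cast
  field_simp

/-- The symbol is a real function bounded below by a positive constant: its summands are positive,
and on `[0, 2π]` the summand with `k = 0` already has a positive minimum. -/
theorem exists_pos_lower_bound_gaussSymbol :
    ∃ δ : ℝ, 0 < δ ∧ ∀ ξ ∈ Set.Icc (0 : ℝ) (2 * Real.pi),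
      ∃ s : ℝ, δ ≤ s ∧ gaussSymbol ξ = (s : ℂ) := by
  refine ⟨√Real.pi * Real.exp (-(2 * Real.pi) ^ 2 / 4), by positivity, fun ξ hξ => ?_⟩
  have hsum := summable_fourierHat_gaussPhi ξ
  simp only [fourierHat_gaussPhi] at hsum
  rw [Complex.summable_ofReal] at hsum
  refine ⟨∑' k : ℤ, √Real.pi * Real.exp (-(ξ + 2 * Real.pi * (k : ℝ)) ^ 2 / 4), ?_, ?_⟩
  · refine le_trans ?_ (hsum.le_tsum 0 fun k _ => by positivity)
    have : ξ ^ 2 ≤ (2 * Real.pi) ^ 2 := pow_le_pow_left₀ hξ.1 hξ.2 2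
    have h : -(2 * Real.pi) ^ 2 / 4 ≤ -(ξ + 2 * Real.pi * ((0 : ℤ) : ℝ)) ^ 2 / 4 := by
      simp; linarith
    gcongr
  · simp only [gaussSymbol, fourierHat_gaussPhi]
    exact (ofReal_tsum _).symm

theorem integral_gaussSymbol_mul_expMode (j : ℤ) :
    ∫ ξ in (0 : ℝ)..2 * Real.pi, gaussSymbol ξ * expMode (-j) ξ = 2 * Real.pi * gaussPhi j := by
  have hint := intervalIntegral.hasSum_integral_of_dominated_convergence (μ := volume)
    (a := 0) (b := 2 * Real.pi)
    (F := fun (k : ℤ) ξ => (gaussPhi k : ℂ) * expMode k ξ * expMode (-j) ξ)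
    (f := fun ξ => gaussSymbol ξ * expMode (-j) ξ) (fun k _ => gaussPhi k)
    (fun k => ((continuous_const.mul (continuous_expMode _)).mul
      (continuous_expMode _)).aestronglyMeasurable)
    (fun k => ae_of_all _ fun ξ _ => by
      rw [norm_mul, norm_mul, norm_expMode, norm_expMode, mul_one, mul_one, norm_real]
      exact (Real.norm_of_nonneg (Real.exp_pos _).le).le)
    (ae_of_all _ fun ξ _ => summable_gaussPhi) intervalIntegrable_const
    (ae_of_all _ fun ξ _ => (hasSum_gaussSymbol ξ).mul_right _)
  refine hint.unique ?_
  simp only [mul_assoc, ← expMode_add, intervalIntegral.integral_const_mul, integral_expMode]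
  have h (k : ℤ) : ((gaussPhi k : ℂ) * if k + -j = 0 then 2 * (Real.pi : ℂ) else 0) =
      if k = j then 2 * (Real.pi : ℂ) * gaussPhi j else 0 := by
    by_cases h : k = j
    · simp [h]; ring
    · rw [if_neg (by omega), if_neg h, mul_zero]
  simp only [h]
  rw [← mul_assoc (2 : ℂ)]
  exact hasSum_ite_eq j _

theorem integral_gaussSymbol_mul_trigPoly {n : ℕ} (a : CentralIdx n → ℂ) (j : CentralIdx n) :
    ∫ ξ in (0 : ℝ)..2 * Real.pi, gaussSymbol ξ * trigPoly a ξ * expMode (-(j : ℤ)) ξ =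
      2 * Real.pi * ∑ k, (gaussToeplitz n j k : ℂ) * a k := by
  have h (ξ : ℝ) : gaussSymbol ξ * trigPoly a ξ * expMode (-(j : ℤ)) ξ =
      ∑ k : CentralIdx n, a k * (gaussSymbol ξ * expMode (-((j : ℤ) - (k : ℤ))) ξ) := by
    rw [trigPoly, Finset.mul_sum, Finset.sum_mul]
    refine Finset.sum_congr rfl fun k _ => ?_
    rw [neg_sub, sub_eq_add_neg, expMode_add]
    ring
  simp only [h]
  rw [intervalIntegral.integral_finsetSum]
  · simp only [intervalIntegral.integral_const_mul, integral_gaussSymbol_mul_expMode]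
    rw [Finset.mul_sum]
    refine Finset.sum_congr rfl fun k _ => ?_
    simp [gaussToeplitz]
    ring
  · exact fun k _ => (continuous_const.mul (contDiff_gaussSymbol.continuous.mul
      (continuous_expMode _))).intervalIntegrable _ _

/-! ### Fourier series of twice differentiable periodic functions -/

theorem Function.Periodic.deriv {f : ℝ → ℂ} {T : ℝ} (hf : Function.Periodic f T) :
    Function.Periodic (deriv f) T := fun x => by
  rw [← deriv_comp_add_const, hf.funext]

theorem norm_fourierCoeffOn_le {a b : ℝ} (hab : a < b) {f : ℝ → ℂ} {C : ℝ}
    (hC : ∀ x ∈ Set.Icc a b, ‖f x‖ ≤ C) (n : ℤ) : ‖fourierCoeffOn hab f n‖ ≤ C := by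
  have hT : 0 < b - a := sub_pos.2 hab
  have : Fact (0 < b - a) := ⟨hT⟩
  rw [fourierCoeffOn_eq_integral, norm_smul]
  have h : ‖∫ x in a..b, fourier (-n) (x : AddCircle (b - a)) • f x‖ ≤ C * |b - a| := by
    refine intervalIntegral.norm_integral_le_of_norm_le_const fun x hx => ?_
    rw [Set.uIoc_of_le hab.le] at hx
    rw [norm_smul, fourier_apply, Circle.norm_coe, one_mul]
    exact hC x ⟨hx.1.le, hx.2⟩
  rw [abs_of_pos hT] at h
  rw [Real.norm_of_nonneg (by positivity), one_div, inv_mul_le_iff₀ hT]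
  linarith

theorem norm_fourierCoeffOn_eq_of_contDiff {T : ℝ} (hT : 0 < 0 + T) {f : ℝ → ℂ}
    (hf : ContDiff ℝ 1 f) (hper : Function.Periodic f T) {n : ℤ} (hn : n ≠ 0) :
    ‖fourierCoeffOn hT f n‖ =
      T / (2 * Real.pi) * ‖fourierCoeffOn hT (deriv f) n‖ / |(n : ℝ)| := by
  have h0 : f (0 + T) = f 0 := hper 0
  rw [fourierCoeffOn_of_hasDerivAt hT hn
      (fun x _ => (hf.differentiable one_ne_zero x).hasDerivAt)
      ((hf.continuous_deriv le_rfl).intervalIntegrable _ _), h0]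
  have hT' : 0 < T := by simpa using hT
  simp only [sub_self, mul_zero, zero_sub, zero_add, ofReal_zero, sub_zero, norm_mul, norm_div,
    norm_neg, norm_one, norm_real, norm_I, mul_one, norm_intCast, Complex.norm_ofNat,
    Real.norm_of_nonneg hT'.le, Real.norm_of_nonneg Real.pi_pos.le]
  field_simp

/-- The Fourier coefficients of a periodic `C²` function decay quadratically, so its Fourier series
converges uniformly. -/
theorem exists_uniform_fourier_series {T : ℝ} [hT : Fact (0 < T)] {f : ℝ → ℂ}
    (hf : ContDiff ℝ 2 f) (hper : Function.Periodic f T) :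
    ∃ d : ℤ → ℂ, ∀ ε : ℝ, 0 < ε → ∃ N : ℕ, ∀ n ≥ N, ∀ x : ℝ,
      ‖f x - ∑ j ∈ Finset.Icc (-(n : ℤ)) n, d j * fourier j (x : AddCircle T)‖ ≤ ε := by
  let F : C(AddCircle T, ℂ) := ⟨hper.lift, continuous_coinduced_dom.mpr hf.continuous⟩
  have hTT : 0 < 0 + T := by simpa using hT.out
  have hF (n : ℤ) : fourierCoeff F n = fourierCoeffOn hTT f n := by
    rw [fourierCoeffOn_eq_integral, fourierCoeff_eq_intervalIntegral _ n 0]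
    congr 1
    · simp
    · refine intervalIntegral.integral_congr fun x _ => ?_
      simp only [fourier_coe_apply, zero_add, sub_zero]
      rfl
  have hf1 : ContDiff ℝ 1 (deriv f) := by
    have : ContDiff ℝ (1 + 1) f := by norm_num; exact hf
    exact this.deriv'
  obtain ⟨C, hC⟩ := isCompact_Icc.exists_bound_of_continuousOn
    (hf1.continuous_deriv le_rfl).continuousOn (s := Set.Icc 0 (0 + T))
  have hsum : Summable (fourierCoeff F) := by
    have hs : Summable fun n : ℤ => (T / (2 * Real.pi)) ^ 2 * C * (1 / |(n : ℝ)| ^ 2) := by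
      have h2 := Real.summable_one_div_int_pow.2 one_lt_two
      simp only [sq_abs]
      exact h2.mul_left _
    refine hs.of_norm_bounded_eventually ?_
    filter_upwards [eventually_cofinite_ne (0 : ℤ)] with n hn
    rw [hF, norm_fourierCoeffOn_eq_of_contDiff hTT (hf.of_le one_le_two) hper hn,
      norm_fourierCoeffOn_eq_of_contDiff hTT hf1 hper.deriv hn]
    have hn' : 0 < |(n : ℝ)| := by positivity
    have hT' := hT.out
    have hle := norm_fourierCoeffOn_le hTT hC n
    calc _ = (T / (2 * Real.pi)) ^ 2 * ‖fourierCoeffOn hTT (deriv (deriv f)) n‖ *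
          (1 / |(n : ℝ)| ^ 2) := by field_simp
      _ ≤ _ := by gcongr
  refine ⟨fourierCoeff F, fun ε hε => ?_⟩
  have ht := (hasSum_fourier_series_of_summable hsum).comp Finset.tendsto_Icc_neg
  obtain ⟨N, hN⟩ := Metric.tendsto_atTop.1 ht ε hε
  refine ⟨N, fun n hn x => ?_⟩
  have h1 := (ContinuousMap.dist_apply_le_dist (f := ∑ j ∈ Finset.Icc (-(n : ℤ)) n,
    fourierCoeff F j • fourier j) (g := F) (x : AddCircle T)).trans (hN n hn).le
  rw [dist_comm, dist_eq_norm] at h1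
  simpa [F, ContinuousMap.sum_apply] using h1

/-! ### Finite sections as weighted least squares -/

/-- If `A_n c = t e⁰`, then `σ ∑ c_j e^{ijξ} - t` is orthogonal to all trigonometric polynomials of
degree at most `n`. Hence `∑ c_j e^{ijξ}` is the best approximation of `t / σ` in `L²(σ)`, and is as
close to any other approximant `∑ d_j e^{ijξ}` as the latter is to `t / σ`. The case `t = 0`, `d = 0`, `η = 0` is the
injectivity of `A_n`. -/
theorem norm_sub_le_of_gaussToeplitz_mulVec_eq {δ η t : ℝ} (hδ : 0 < δ) (hη : 0 ≤ η)
    (hσ : ∀ ξ ∈ Set.Icc (0 : ℝ) (2 * Real.pi), ∃ s : ℝ, δ ≤ s ∧ gaussSymbol ξ = (s : ℂ))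
    {n : ℕ} {c : CentralIdx n → ℝ} (hc : gaussToeplitz n *ᵥ c = t • centralUnit n)
    {d : CentralIdx n → ℂ}
    (hd : ∀ ξ ∈ Set.Icc (0 : ℝ) (2 * Real.pi), ‖gaussSymbol ξ * trigPoly d ξ - t‖ ≤ η)
    (j : CentralIdx n) : ‖(c j : ℂ) - d j‖ ≤ η / δ := by
  set c' : CentralIdx n → ℂ := fun j => (c j : ℂ) with hc'
  set r := c' - d with hr
  have hS := contDiff_gaussSymbol.continuous
  have hcontG : Continuous fun ξ => gaussSymbol ξ * trigPoly c' ξ - t :=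
    (hS.mul (continuous_trigPoly _)).sub continuous_const
  have hcontH : Continuous fun ξ => (gaussSymbol ξ * trigPoly c' ξ - t) * conj (trigPoly r ξ) :=
    hcontG.mul (continuous_conj.comp (continuous_trigPoly _))
  have hcontRe : Continuous fun ξ =>
      ((gaussSymbol ξ * trigPoly c' ξ - t) * conj (trigPoly r ξ)).re := continuous_re.comp hcontH
  have horth (j : CentralIdx n) : ∫ ξ in (0 : ℝ)..2 * Real.pi,
      (gaussSymbol ξ * trigPoly c' ξ - t) * expMode (-(j : ℤ)) ξ = 0 := by
    simp only [sub_mul]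
    rw [intervalIntegral.integral_sub, integral_gaussSymbol_mul_trigPoly,
      intervalIntegral.integral_const_mul, integral_expMode]
    · have h := congrArg (fun v : CentralIdx n → ℝ => ((v j : ℝ) : ℂ)) hc
      simp only [Matrix.mulVec, dotProduct, Pi.smul_apply, centralUnit, smul_eq_mul] at h
      push_cast at h
      rw [h]
      by_cases h0 : (j : ℤ) = 0
      · simp [h0]; ring
      · simp [h0]
    · exact ((hS.mul (continuous_trigPoly _)).mul (continuous_expMode _)).intervalIntegrable _ _
    · exact (continuous_const.mul (continuous_expMode _)).intervalIntegrable _ _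
  have hH : ∫ ξ in (0 : ℝ)..2 * Real.pi,
      (gaussSymbol ξ * trigPoly c' ξ - t) * conj (trigPoly r ξ) = 0 := by
    rw [integral_mul_conj_trigPoly hcontG]
    simp [horth]
  have hHre : ∫ ξ in (0 : ℝ)..2 * Real.pi,
      ((gaussSymbol ξ * trigPoly c' ξ - t) * conj (trigPoly r ξ)).re = 0 := by
    have := intervalIntegral.intervalIntegral_re (𝕜 := ℂ)
      (hcontH.intervalIntegrable (μ := volume) 0 (2 * Real.pi))
    simpa [hH] using this
  -- The cross term `η ‖P‖` is absorbed by `η ‖P‖ ≤ δ / 2 ‖P‖² + η² / (2 δ)`.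
  have hpt : ∀ ξ ∈ Set.Icc (0 : ℝ) (2 * Real.pi), δ / 2 * ‖trigPoly r ξ‖ ^ 2 ≤ η ^ 2 / (2 * δ) +
      ((gaussSymbol ξ * trigPoly c' ξ - t) * conj (trigPoly r ξ)).re := by
    intro ξ hξ
    obtain ⟨s, hs, hsS⟩ := hσ ξ hξ
    have hsplit : (gaussSymbol ξ * trigPoly c' ξ - t) * conj (trigPoly r ξ) =
        ((s * ‖trigPoly r ξ‖ ^ 2 : ℝ) : ℂ) +
          (gaussSymbol ξ * trigPoly d ξ - t) * conj (trigPoly r ξ) := by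
      push_cast
      rw [← mul_conj', ← hsS, hr, trigPoly_sub]
      ring
    have hcross : -((gaussSymbol ξ * trigPoly d ξ - t) * conj (trigPoly r ξ)).re ≤
        η * ‖trigPoly r ξ‖ := by
      refine (neg_le_abs _).trans ((abs_re_le_norm _).trans ?_)
      rw [norm_mul, norm_conj]
      exact mul_le_mul_of_nonneg_right (hd ξ hξ) (norm_nonneg _)
    rw [hsplit, add_re, ofReal_re]
    have h1 : δ * ‖trigPoly r ξ‖ ^ 2 ≤ s * ‖trigPoly r ξ‖ ^ 2 := by gcongr
    have h2 : δ / 2 * ‖trigPoly r ξ‖ ^ 2 + η ^ 2 / (2 * δ) - η * ‖trigPoly r ξ‖ =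
        (δ * ‖trigPoly r ξ‖ - η) ^ 2 / (2 * δ) := by field_simp; ring
    have h3 : 0 ≤ (δ * ‖trigPoly r ξ‖ - η) ^ 2 / (2 * δ) := by positivity
    linarith
  have hint := intervalIntegral.integral_mono_on (μ := volume) Real.two_pi_pos.le
    ((continuous_const.mul ((continuous_trigPoly r).norm.pow 2)).intervalIntegrable _ _)
    ((continuous_const.add hcontRe).intervalIntegrable _ _) hpt
  simp only [Pi.add_apply, Pi.mul_apply, Pi.pow_apply] at hint
  rw [intervalIntegral.integral_const_mul, integral_norm_sq_trigPoly,
    intervalIntegral.integral_add intervalIntegrable_const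
      (hcontRe.intervalIntegrable _ _), hHre,
    intervalIntegral.integral_const, smul_eq_mul] at hint
  have hle : ‖r j‖ ^ 2 ≤ ∑ j, ‖r j‖ ^ 2 :=
    Finset.single_le_sum (f := fun j => ‖r j‖ ^ 2) (fun _ _ => by positivity) (Finset.mem_univ j)
  have hsq : ∑ j, ‖r j‖ ^ 2 ≤ (η / δ) ^ 2 := by
    rw [sub_zero, add_zero] at hint
    have hp : 0 < Real.pi * δ := mul_pos Real.pi_pos hδ
    refine le_of_mul_le_mul_left ?_ hp
    calc _ = δ / 2 * (2 * Real.pi * ∑ j, ‖r j‖ ^ 2) := by ring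
      _ ≤ _ := hint
      _ = _ := by field_simp
  exact abs_le_of_sq_le_sq' (hle.trans hsq) (by positivity) |>.2

theorem existsUnique_gaussToeplitz_mulVec_eq (n : ℕ) (v : CentralIdx n → ℝ) :
    ∃! c : CentralIdx n → ℝ, gaussToeplitz n *ᵥ c = v := by
  obtain ⟨δ, hδ, hσ⟩ := exists_pos_lower_bound_gaussSymbol
  have hinj : Function.Injective (Matrix.mulVecLin (gaussToeplitz n)) := by
    rw [injective_iff_map_eq_zero]
    intro c hc
    funext j
    have h := norm_sub_le_of_gaussToeplitz_mulVec_eq (t := 0) hδ le_rfl hσ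
      (c := c) (d := 0) (by simpa using hc) (by simp [trigPoly]) j
    simpa using h
  exact Function.bijective_iff_existsUnique _ |>.1
    ⟨hinj, LinearMap.injective_iff_surjective.1 hinj⟩ v

/-! ### Convergence of the truncated symbols -/

/-- The Fourier partial sums `q_n` of `1 / σ` satisfy `σ q_n → 1` uniformly. -/
theorem exists_trigPoly_inverse_gaussSymbol :
    ∃ d : ℤ → ℂ, ∀ ε : ℝ, 0 < ε → ∃ N : ℕ, ∀ n ≥ N, ∀ ξ ∈ Set.Icc (0 : ℝ) (2 * Real.pi),
      ‖gaussSymbol ξ * trigPoly (fun j : CentralIdx n => d j) ξ - 1‖ ≤ ε := by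
  obtain ⟨δ, hδ, hσ⟩ := exists_pos_lower_bound_gaussSymbol
  have hS := contDiff_gaussSymbol.continuous
  have hne (ξ : ℝ) : gaussSymbol ξ ≠ 0 := by
    obtain ⟨y, hy, hyξ⟩ := gaussSymbol_periodic.exists_mem_Ico₀ Real.two_pi_pos ξ
    obtain ⟨s, hs, hsS⟩ := hσ y (Set.Ico_subset_Icc_self hy)
    rw [hyξ, hsS, ofReal_ne_zero]
    linarith
  have : Fact (0 < 2 * Real.pi) := ⟨Real.two_pi_pos⟩
  obtain ⟨d, hd⟩ := exists_uniform_fourier_series (T := 2 * Real.pi)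
    (f := fun ξ => (gaussSymbol ξ)⁻¹) ((contDiff_gaussSymbol.of_le le_top).inv hne)
    (fun ξ => by simp only [gaussSymbol_periodic ξ])
  obtain ⟨M, hM⟩ := isCompact_Icc.exists_bound_of_continuousOn
    hS.continuousOn (s := Set.Icc 0 (2 * Real.pi))
  refine ⟨d, fun ε hε => ?_⟩
  have hM1 : 0 < |M| + 1 := by positivity
  obtain ⟨N, hN⟩ := hd (ε / (|M| + 1)) (by positivity)
  refine ⟨N, fun n hn ξ hξ => ?_⟩
  have hq : trigPoly (fun j : CentralIdx n => d j) ξ =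
      ∑ j ∈ Finset.Icc (-(n : ℤ)) n, d j * fourier j (ξ : AddCircle (2 * Real.pi)) := by
    rw [trigPoly, Finset.sum_coe_sort (Finset.Icc (-(n : ℤ)) n) fun j => d j * expMode j ξ]
    refine Finset.sum_congr rfl fun j _ => ?_
    have hpi : (Real.pi : ℂ) ≠ 0 := ofReal_ne_zero.2 Real.pi_ne_zero
    rw [fourier_coe_apply, expMode]
    push_cast
    congr 2
    field_simp
  have h := hN n hn ξ
  rw [← hq, norm_sub_rev] at h
  have hfac : gaussSymbol ξ * trigPoly (fun j : CentralIdx n => d j) ξ - 1 =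
      gaussSymbol ξ * (trigPoly (fun j : CentralIdx n => d j) ξ - (gaussSymbol ξ)⁻¹) := by
    rw [mul_sub, mul_inv_cancel₀ (hne ξ)]
  rw [hfac, norm_mul]
  calc _ ≤ (|M| + 1) * (ε / (|M| + 1)) := by
        gcongr
        linarith [hM ξ hξ, le_abs_self M]
    _ = ε := mul_div_cancel₀ _ hM1.ne'

theorem bandedSymbol_eq_trigPoly {m n : ℕ} (h : m ≤ n) (c : CentralIdx n → ℝ) (ξ : ℝ) :
    bandedSymbol h c ξ = trigPoly (fun j => (c (CentralIdx.incl h j) : ℂ)) ξ := rfl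

theorem mainTheorem2 :
    (∀ ξ : ℝ, Summable fun k : ℤ => fourierHat gaussPhi (ξ + 2 * Real.pi * (k : ℝ))) ∧
    (∀ n : ℕ, 0 < n → ∃! c : CentralIdx n → ℝ, gaussToeplitz n *ᵥ c = centralUnit n) ∧
    (∀ ε : ℝ, 0 < ε →
      ∃ m n₀ : ℕ, 0 < m ∧ 0 < n₀ ∧ ∃ hm : m ≤ n₀,
        ∀ (n : ℕ) (hn : n₀ ≤ n) (c : CentralIdx n → ℝ),
          gaussToeplitz n *ᵥ c = centralUnit n →
          ∀ ξ ∈ Set.Icc (0 : ℝ) (2 * Real.pi),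
            ‖gaussSymbol ξ * bandedSymbol (hm.trans hn) c ξ - 1‖ ≤ ε) := by
  refine ⟨summable_fourierHat_gaussPhi, fun n _ => existsUnique_gaussToeplitz_mulVec_eq n _,
    fun ε hε => ?_⟩
  obtain ⟨δ, hδ, hσ⟩ := exists_pos_lower_bound_gaussSymbol
  obtain ⟨d, hd⟩ := exists_trigPoly_inverse_gaussSymbol
  obtain ⟨M, hM⟩ := isCompact_Icc.exists_bound_of_continuousOn
    contDiff_gaussSymbol.continuous.continuousOn (s := Set.Icc 0 (2 * Real.pi))
  obtain ⟨m₀, hm₀⟩ := hd (ε / 2) (by positivity)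
  set m := m₀ + 1 with hm
  set K : ℝ := (|M| + 1) * (2 * m + 1) with hK
  have hK0 : 0 < K := by positivity
  -- `η` is chosen so that `m`-banded coefficient errors of size `η / δ` contribute at most `ε / 2`.
  set η : ℝ := ε / 2 * δ / K with hη
  have hη0 : 0 < η := by positivity
  obtain ⟨N, hN⟩ := hd η hη0
  refine ⟨m, max m N, by omega, by omega, le_max_left _ _, fun n hn c hc ξ hξ => ?_⟩
  have hmn : m ≤ n := (le_max_left _ _).trans hn
  have hcoef := norm_sub_le_of_gaussToeplitz_mulVec_eq (t := 1) hδ hη0.le hσ (by simpa using hc)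
    (d := fun j => d j) (by simpa using hN n ((le_max_right _ _).trans hn))
  have h1 := hm₀ m (by omega) ξ hξ
  rw [bandedSymbol_eq_trigPoly]
  have hsplit : gaussSymbol ξ * trigPoly (fun j => (c (CentralIdx.incl hmn j) : ℂ)) ξ - 1 =
      gaussSymbol ξ * trigPoly ((fun j => (c (CentralIdx.incl hmn j) : ℂ)) -
        fun j : CentralIdx m => d j) ξ +
      (gaussSymbol ξ * trigPoly (fun j : CentralIdx m => d j) ξ - 1) := by
    rw [trigPoly_sub]; ring
  have h2 : ‖trigPoly ((fun j => (c (CentralIdx.incl hmn j) : ℂ)) -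
      fun j : CentralIdx m => d j) ξ‖ ≤ (2 * m + 1) * (η / δ) :=
    norm_trigPoly_le (fun j => hcoef (CentralIdx.incl hmn j)) ξ
  have h3 : ‖gaussSymbol ξ‖ ≤ |M| + 1 := by linarith [hM ξ hξ, le_abs_self M]
  rw [hsplit]
  refine (norm_add_le _ _).trans ?_
  rw [norm_mul]
  calc _ ≤ (|M| + 1) * ((2 * m + 1) * (η / δ)) + ε / 2 := by gcongr
    _ = ε := by rw [hη, hK]; field_simp; ring
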